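/- Let $(V,\eta)$ be the Lorentzian vector space of signature $(1,10)$ ("mostly minus"), with Clifford relation $v\cdot v=-\eta(v,v)1$. Let $S$ be its spinor module, a $32$-dimensional real $\mathrm{Cl}(V)$-module, with a symplectic form $\langle-,-\rangle$ such that $\langle v\cdot s,t\rangle=-\langle s,v\cdot t\rangle$ for $v\in V$, $s,t\in S$. Let $\sigma:\mathfrak{so}(V)\to\mathfrak{gl}(S)$ be the spinor representation. The Dirac current is the symmetric bilinear map $\kappa:S\times S\to V$ with $\eta(\kappa(s,t),v)=\langle s,v\cdot t\rangle$. For $\varphi\in\Lambda^4V$ set $$\beta^\varphi_v(s)=\beta^\varphi(v,s)=\tfrac1{24}(v\cdot\varphi-3\varphi\cdot v)\cdot s,\qquad \gamma^\varphi(s,t)v=-\kappa(\beta^\varphi_v s,t)-\kappa(\beta^\varphi_v t,s).$$ The map $\gamma^\varphi$ takes values in $\mathfrak{so}(V)$, and $\gamma^\varphi(s,s)v=-2\kappa(\beta^\varphi_vs,s)$. Write $\kappa(\omega)$ and $\gamma^\varphi(\omega)$ for the linear extensions of these maps to $\omega\in\odot^2S$. For a subspace $S'\subset S$ put $$\mathfrak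 h=\{\gamma^\varphi(\omega)\mid \omega\in\odot^2S',\ \kappa(\omega)=0\}\subset\mathfrak{so}(V).$$ The pair $(\varphi,S')$ is a Lie pair if $A\cdot\varphi=0$ and $\sigma(A)S'\subset S'$ for all $A\in\mathfrak h$. A section is a linear map $\Sigma:V\to\odot^2S'$ with $\kappa\circ\Sigma=\mathrm{id}_V$. For $A\in\mathfrak{so}(V)$ and $R:\Lambda^2V\to\mathfrak{so}(V)$ linear, put $$(A\beta^\varphi)(v,s)=\sigma(A)\beta^\varphi(v,s)-\beta^\varphi(Av,s)-\beta^\varphi(v,\sigma(A)s),$$ $$(AR)(v,w)=[A,R(v,w)]-R(Av,w)-R(v,Aw).$$ **Theorem 5.1.** Let $(\varphi,S')$ be a Lie pair with $\dim S'>16$, let $\Sigma$ be any section and let $X=\gamma^\varphi\circ\Sigma:V\to\mathfrak{so}(V)$, $v\mapsto X_v$. Assume that $\beta^\varphi(v,s)+\sigma(X_v)s\in S'$ for all $v\in V$, $s\in S'$. Let $R:\Lambda^2V\to\mathfrak{so}(V)$ be a linear map such that, for all $s\in S'$ and $v,w\in V$, $$\tfrac12R(v,\kappa(s,s))w=\kappa\big((X_v\beta^\varphi)(w,s),s\big)+\gamma^\varphi(\beta^\varphi_v(s),s)w,$$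 $$\sigma(R(v,w))s=(X_v\beta^\varphi)(w,s)-(X_w\beta^\varphi)(v,s)+[\beta^\varphi_v,\beta^\varphi_w](s).$$ Then, for all $A\in\mathfrak h$, $s\in S'$ and $u,v,w\in V$: 1. $[A,X_v]-X_{Av}\in\mathfrak h$; 2. $\gamma^\varphi(s,s)-X_{\kappa(s,s)}\in\mathfrak h$; 3. $[X_v,X_w]-X_{X_vw-X_wv}+R(v,w)\in\mathfrak h$; 4. $(AR)(v,w)=0$, that is, $R$ is $\mathfrak h$-equivariant; 5. $R(u,v)w+R(v,w)u+R(w,u)v=0$; 6. $(X_uR)(v,w)+(X_vR)(w,u)+(X_wR)(u,v)=0$. -/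

import Mathlib

open scoped TensorProduct

namespace Sugra

noncomputable section

/-! ### The Lorentzian vector space of signature `(1,10)` -/

/-- The eleven-dimensional vector space `V`; the coordinate `0` is the timelike one. -/
abbrev V : Type := Fin 11 → ℝ

/-- The signs `η(eᵢ, eᵢ)` of the "mostly minus" signature `(1,10)`. -/
def sgn (i : Fin 11) : ℝ := if i = 0 then 1 else -1

/-- The standard basis vectors of `V`; they are `η`-orthonormal up to the signs `sgn i`. -/
def e (i : Fin 11) : V := Pi.single i 1

/-- The Lorentzian inner product `η(v,w) = v₀w₀ - v₁w₁ - ⋯ - v₁₀w₁₀`. -/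
def eta : LinearMap.BilinForm ℝ V :=
  LinearMap.mk₂ ℝ (fun v w => ∑ i, sgn i * (v i * w i))
    (fun v v' w => by
      simp only [Pi.add_apply, ← Finset.sum_add_distrib]
      exact Finset.sum_congr rfl fun i _ => by ring)
    (fun c v w => by
      simp only [Pi.smul_apply, smul_eq_mul, Finset.mul_sum]
      exact Finset.sum_congr rfl fun i _ => by ring)
    (fun v w w' => by
      simp only [Pi.add_apply, ← Finset.sum_add_distrib]
      exact Finset.sum_congr rfl fun i _ => by ring)
    (fun c v w => by
      simp only [Pi.smul_apply, smul_eq_mul, Finset.mul_sum]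
      exact Finset.sum_congr rfl fun i _ => by ring)

/-- The quadratic form of the Clifford algebra: the Clifford relation is `v · v = -η(v,v) 1`. -/
def Q : QuadraticForm ℝ V := -eta.toQuadraticMap

/-- The space `so(V)` of `η`-skew endomorphisms of `V`, a Lie subalgebra of `End V` with the
commutator bracket. -/
abbrev so : Submodule ℝ (Module.End ℝ V) := eta.skewAdjointSubmodule

/-! ### Exterior powers of `V` -/

/-- The decomposable bivector `v ∧ w`. -/
def wedge (v w : V) : ⋀[ℝ]^2 V := exteriorPower.ιMulti ℝ 2 ![v, w]

/-- The map `(v₁, …, vₙ) ↦ ∑ₖ v₁ ∧ ⋯ ∧ A vₖ ∧ ⋯ ∧ vₙ`. -/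
def derAlt (n : ℕ) (A : Module.End ℝ V) : V [⋀^Fin n]→ₗ[ℝ] ⋀[ℝ]^n V :=
  { (∑ k : Fin n, (exteriorPower.ιMulti ℝ n (M := V)).toMultilinearMap.compLinearMap
      (Function.update (fun _ => LinearMap.id) k A) :
      MultilinearMap ℝ (fun _ : Fin n => V) (⋀[ℝ]^n V)) with
    map_eq_zero_of_eq' := by
      intro v i j hv hij
      set F : Fin n → Fin n → V := fun k l =>
        (Function.update (fun _ : Fin n => (LinearMap.id : V →ₗ[ℝ] V)) k A) l (v l) with hF
      have hne : ∀ k l, l ≠ k → F k l = v l := fun k l h => by simp [hF, h]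
      have heq : ∀ k, F k k = A (v k) := fun k => by simp [hF]
      have key : ∑ k, exteriorPower.ιMulti ℝ n (F k) = 0 := by
        rw [← Finset.add_sum_erase _ _ (Finset.mem_univ i),
          ← Finset.add_sum_erase _ _ (Finset.mem_erase.2 ⟨hij.symm, Finset.mem_univ j⟩),
          Finset.sum_eq_zero, add_zero]
        · have hsw : F j = F i ∘ Equiv.swap i j := by
            funext l
            simp only [Function.comp]
            rcases eq_or_ne l i with rfl | hi
            · rw [Equiv.swap_apply_left, hne _ _ hij, hne _ _ hij.symm, hv]
            · rcases eq_or_ne l j with rfl | hj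
              · rw [Equiv.swap_apply_right, heq, heq, hv]
              · rw [Equiv.swap_apply_of_ne_of_ne hi hj, hne _ _ hj, hne _ _ hi]
          rw [hsw, AlternatingMap.map_swap _ _ hij, add_neg_cancel]
        · intro k hk
          simp only [Finset.mem_erase] at hk
          refine AlternatingMap.map_eq_zero_of_eq _ _ ?_ hij
          rw [hne _ _ hk.1.symm, hne _ _ hk.2.1.symm, hv]
      simpa [hF] using key }

/-- The action `φ ↦ A · φ` of an endomorphism of `V` on `Λⁿ V`, extended as a derivation. -/
def der (n : ℕ) (A : Module.End ℝ V) : ⋀[ℝ]^n V →ₗ[ℝ] ⋀[ℝ]^n V :=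
  exteriorPower.alternatingMapLinearEquiv (derAlt n A)

/-! ### The spinor module -/

/-- The spinor module structure on a real vector space `S`: a `32`-dimensional (equivalently,
irreducible) real module over `Cl(V) ≅ 2 ℝ(32)` with a symplectic form for which the Clifford
action of vectors is skew. The nonemptiness of this structure is `nonempty_spinorModule`. -/
structure SpinorModule (S : Type*) [AddCommGroup S] [Module ℝ S] where
  finrank_eq : Module.finrank ℝ S = 32
  /-- the Clifford action -/
  cl : CliffordAlgebra Q →ₐ[ℝ] Module.End ℝ S
  /-- the symplectic form `⟨-,-⟩` -/
  form : LinearMap.BilinForm ℝ S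
  form_alt : form.IsAlt
  form_nondegenerate : form.Nondegenerate
  form_cl : ∀ (v : V) (s t : S),
    form (cl (CliffordAlgebra.ι Q v) s) t = -form s (cl (CliffordAlgebra.ι Q v) t)

namespace SpinorModule

variable {S : Type*} [AddCommGroup S] [Module ℝ S] (P : SpinorModule S)

/-- Clifford multiplication `s ↦ v · s` by vectors. -/
def c : V →ₗ[ℝ] Module.End ℝ S := P.cl.toLinearMap ∘ₗ CliffordAlgebra.ι Q

/-- Clifford multiplication `s ↦ φ · s` by four-vectors, through the standard vector space
isomorphism of the Clifford and exterior algebras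
(`e_{i₁} ⋯ e_{iₙ} ↔ e_{i₁} ∧ ⋯ ∧ e_{iₙ}` for distinct indices). -/
def c4 (φ : ⋀[ℝ]^4 V) : Module.End ℝ S :=
  P.cl ((CliffordAlgebra.equivExterior Q).symm (φ : ExteriorAlgebra ℝ V))

/-- The spinor representation `σ(A) = ¼ ∑ᵢ η(eᵢ,eᵢ) eᵢ · A eᵢ` of `A ∈ so(V)`; it satisfies
`[σ(A), v ·] = (A v) ·`, see `sigma_comm`. Only its values on `so(V)` are meaningful. -/
def sigma : Module.End ℝ V →ₗ[ℝ] Module.End ℝ S where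
  toFun A := (1 / 4 : ℝ) • ∑ i, sgn i • (P.c (e i) * P.c (A (e i)))
  map_add' A B := by
    simp only [LinearMap.add_apply, map_add, mul_add, smul_add, Finset.sum_add_distrib]
  map_smul' r A := by
    simp only [LinearMap.smul_apply, map_smul, mul_smul_comm, RingHom.id_apply, Finset.smul_sum]
    exact Finset.sum_congr rfl fun i _ => by
      rw [smul_comm (sgn i) r, smul_comm (1 / 4 : ℝ) r]

/-- The (polarized) Dirac current, given by `η(κ(s,t),v) = ⟨s, v · t⟩`. -/
def kappa : S →ₗ[ℝ] S →ₗ[ℝ] V :=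
  LinearMap.mk₂ ℝ (fun s t i => sgn i * P.form s (P.c (e i) t))
    (fun s s' t => by funext i; simp [mul_add])
    (fun r s t => by funext i; simp; ring)
    (fun s t t' => by funext i; simp [mul_add])
    (fun r s t => by funext i; simp; ring)

/-- `β^φ_v(s) = 1/24 (v · φ - 3 φ · v) · s`. -/
def beta (φ : ⋀[ℝ]^4 V) : V →ₗ[ℝ] Module.End ℝ S :=
  (1 / 24 : ℝ) • (LinearMap.mulRight ℝ (P.c4 φ) ∘ₗ P.c -
    (3 : ℝ) • (LinearMap.mulLeft ℝ (P.c4 φ) ∘ₗ P.c))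

/-- The polarization `γ^φ(s,t) v = -κ(β^φ_v s, t) - κ(β^φ_v t, s)` of the quadratic map
`γ^φ(s,s) v = -2 κ(β^φ_v s, s)`. Its values lie in `so(V)`,
see `gamma_mem_so`. -/
def gamma (φ : ⋀[ℝ]^4 V) : S →ₗ[ℝ] S →ₗ[ℝ] Module.End ℝ V :=
  LinearMap.mk₂ ℝ
    (fun s t => -(P.kappa.flip t ∘ₗ (P.beta φ).flip s) - P.kappa.flip s ∘ₗ (P.beta φ).flip t)
    (fun s s' t => by refine LinearMap.ext fun v => ?_; simp; abel)
    (fun r s t => by refine LinearMap.ext fun v => ?_; simp [smul_sub])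
    (fun s t t' => by refine LinearMap.ext fun v => ?_; simp; abel)
    (fun r s t => by refine LinearMap.ext fun v => ?_; simp [smul_sub])

/-- The symmetric square `⊙² S'`, as the space of symmetric tensors in `S ⊗ S`
with both legs in `S'`. -/
def symSq (S' : Submodule ℝ S) : Submodule ℝ (S ⊗[ℝ] S) :=
  Submodule.span ℝ {ω | ∃ s ∈ S', ω = s ⊗ₜ[ℝ] s}

/-- The Dirac current `ω ↦ ω⁽¹⁾` on bispinors. -/
def kappa₂ : S ⊗[ℝ] S →ₗ[ℝ] V := TensorProduct.lift P.kappa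

/-- The map `ω ↦ γ^φ(ω)` on bispinors. -/
def gamma₂ (φ : ⋀[ℝ]^4 V) : S ⊗[ℝ] S →ₗ[ℝ] Module.End ℝ V := TensorProduct.lift (P.gamma φ)

/-- The Dirac kernel of `S'`. -/
def diracKernel (S' : Submodule ℝ S) : Submodule ℝ (S ⊗[ℝ] S) :=
  symSq S' ⊓ LinearMap.ker P.kappa₂

/-- The subspace `h = γ^φ(D)` of `so(V)`, where `D` is the Dirac kernel of `S'`. -/
def isotropy (φ : ⋀[ℝ]^4 V) (S' : Submodule ℝ S) : Submodule ℝ (Module.End ℝ V) :=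
  (P.diracKernel S').map (P.gamma₂ φ)

/-- Lie pairs: `A · φ = 0` and `σ(A) S' ⊆ S'` for all `A ∈ h`. -/
def IsLiePair (φ : ⋀[ℝ]^4 V) (S' : Submodule ℝ S) : Prop :=
  ∀ A ∈ P.isotropy φ S', der 4 A φ = 0 ∧ ∀ s ∈ S', P.sigma A s ∈ S'

/-- Sections `V → ⊙² S'` of the Dirac current. -/
def IsSection (S' : Submodule ℝ S) (Sec : V →ₗ[ℝ] S ⊗[ℝ] S) : Prop :=
  ∀ v, Sec v ∈ symSq S' ∧ P.kappa₂ (Sec v) = v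

/-- The action of `A ∈ so(V)` on `β^φ`:
`(A β^φ)(v,s) = σ(A) β^φ(v,s) - β^φ(A v, s) - β^φ(v, σ(A) s)`. -/
def actBeta (φ : ⋀[ℝ]^4 V) (A : Module.End ℝ V) (v : V) (s : S) : S :=
  P.sigma A (P.beta φ v s) - P.beta φ (A v) s - P.beta φ v (P.sigma A s)

end SpinorModule

/-- The action of `A ∈ so(V)` on `R : Λ² V → so(V)`:
`(A R)(v,w) = [A, R(v,w)] - R(A v, w) - R(v, A w)`. -/
def actCurv (A : Module.End ℝ V) (R : ⋀[ℝ]^2 V →ₗ[ℝ] so) (v w : V) : Module.End ℝ V :=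
  ⁅A, (R (wedge v w) : Module.End ℝ V)⁆ - R (wedge (A v) w) - R (wedge v (A w))

/-! ### The definitions have the stated meaning -/


theorem eta_e_left (i : Fin 11) (v : V) : eta (e i) v = sgn i * v i := by
  simp [eta, e, Pi.single_apply]

theorem Q_apply (v : V) : Q v = -∑ i, sgn i * (v i * v i) := by
  simp [Q, eta]

variable {S : Type*} [AddCommGroup S] [Module ℝ S] (P : SpinorModule S)

theorem clifford (v w : V) : P.c v * P.c w + P.c w * P.c v = (-2 * eta v w) • 1 := by
  have h := CliffordAlgebra.ι_mul_ι_add_swap (Q := Q) v w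
  have h2 := congrArg P.cl h
  simp only [map_add, map_mul] at h2
  have hp : QuadraticMap.polar Q v w = -2 * eta v w := by
    simp only [QuadraticMap.polar, Q_apply, eta, LinearMap.mk₂_apply, Pi.add_apply, Finset.mul_sum,
      ← Finset.sum_neg_distrib, ← Finset.sum_sub_distrib]
    exact Finset.sum_congr rfl fun i _ => by ring
  rw [hp, AlgHom.commutes] at h2
  simpa [SpinorModule.c, Algebra.smul_def] using h2

theorem sum_e (v : V) : ∑ i, (v i) • e i = v := by
  funext j; simp [e, Finset.sum_apply, Pi.single_apply]

/-- `σ(A)` implements `A` on vectors, `[σ(A), v ·] = (A v) ·`, for `A ∈ so(V)`. -/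
theorem sigma_comm (A : Module.End ℝ V) (hA : A ∈ so) (v : V) :
    P.sigma A * P.c v - P.c v * P.sigma A = P.c (A v) := by
  have hA' : ∀ x y, eta (A x) y = -eta x (A y) := by
    intro x y
    have := (LinearMap.mem_skewAdjointSubmodule (B := eta) A).1 hA x y
    simpa using this
  have hsq : ∀ i, sgn i * sgn i = 1 := by intro i; unfold sgn; split_ifs <;> norm_num
  have comm : ∀ x y w : V, P.c x * P.c y * P.c w - P.c w * (P.c x * P.c y)
      = (-2 * eta y w) • P.c x + (2 * eta x w) • P.c y := by
    intro x y w
    have h1 : P.c y * P.c w = (-2 * eta y w) • 1 - P.c w * P.c y := by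
      rw [← clifford P y w]; abel
    have h2 : P.c x * P.c w = (-2 * eta x w) • 1 - P.c w * P.c x := by
      rw [← clifford P x w]; abel
    rw [mul_assoc, h1, mul_sub, ← mul_assoc, h2]
    simp only [sub_mul, smul_mul_assoc, mul_smul_comm, one_mul, mul_one, mul_assoc]
    module
  simp only [SpinorModule.sigma, LinearMap.coe_mk, AddHom.coe_mk, smul_mul_assoc, mul_smul_comm,
    ← smul_sub, Finset.sum_mul, Finset.mul_sum, ← Finset.sum_sub_distrib, comm]
  have h3 : ∀ i, sgn i • ((-2 * eta (A (e i)) v) • P.c (e i) + (2 * eta (e i) v) • P.c (A (e i)))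
      = (2 * (A v) i) • P.c (e i) + (2 * v i) • P.c (A (e i)) := by
    intro i
    rw [hA', eta_e_left, eta_e_left, smul_add, smul_smul, smul_smul]
    congr 2
    · linear_combination 2 * (A v i) * hsq i
    · linear_combination 2 * (v i) * hsq i
  rw [Finset.sum_congr rfl fun i _ => h3 i]
  simp only [Finset.sum_add_distrib, mul_smul, ← Finset.smul_sum]
  have h4 : ∑ i, (A v i) • P.c (e i) = P.c (A v) := by
    conv_rhs => rw [← sum_e (A v)]
    simp only [map_sum, map_smul]
  have h5 : ∑ i, (v i) • P.c (A (e i)) = P.c (A v) := by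
    conv_rhs => rw [← sum_e v]
    simp only [map_sum, map_smul]
  rw [h4, h5]; module

/-- The defining property of the Dirac current. -/
theorem eta_kappa (s t : S) (v : V) : eta (P.kappa s t) v = P.form s (P.c v t) := by
  have hsq : ∀ i, sgn i * sgn i = 1 := by intro i; unfold sgn; split_ifs <;> norm_num
  conv_rhs => rw [← sum_e v]
  simp only [eta, SpinorModule.kappa, LinearMap.mk₂_apply, map_sum, map_smul, LinearMap.sum_apply,
    LinearMap.smul_apply, smul_eq_mul]
  exact Finset.sum_congr rfl fun i _ => by linear_combination v i * P.form s (P.c (e i) t) * hsq i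

theorem der_apply (A : Module.End ℝ V) (v w : V) :
    der 2 A (wedge v w) = wedge (A v) w + wedge v (A w) := by
  simp only [der, wedge, exteriorPower.alternatingMapLinearEquiv_apply_ιMulti]
  change (∑ k : Fin 2, (exteriorPower.ιMulti ℝ 2 (M := V)).toMultilinearMap.compLinearMap
      (Function.update (fun _ => LinearMap.id) k A)) ![v, w] = _
  rw [Fin.sum_univ_two]
  change exteriorPower.ιMulti ℝ 2 _ + exteriorPower.ιMulti ℝ 2 _ = _
  congr 2 <;> (funext k; fin_cases k <;> rfl)


theorem eta_e (i j : Fin 11) (h : i ≠ j) : eta (e i) (e j) = 0 := by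
  rw [eta_e_left]; simp [e, h]

theorem assoc_Q (v w : V) : QuadraticMap.associated (-Q) v w = eta v w := by
  simp [QuadraticMap.associated_apply, Q, eta]
  rw [← Finset.sum_add_distrib, ← Finset.sum_sub_distrib, ← Finset.sum_sub_distrib, Finset.mul_sum]
  exact Finset.sum_congr rfl fun i _ => by ring

/-- `(e_a ∧ e_b ∧ e_c ∧ e_d) · s = e_a · e_b · e_c · e_d · s` for distinct indices. -/
theorem c4_basis (a b c d : Fin 11) (hab : a ≠ b) (hac : a ≠ c) (had : a ≠ d) (hbc : b ≠ c)
    (hbd : b ≠ d) (hcd : c ≠ d) :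
    P.c4 (exteriorPower.ιMulti ℝ 4 ![e a, e b, e c, e d]) =
      P.c (e a) * P.c (e b) * P.c (e c) * P.c (e d) := by
  have key : (CliffordAlgebra.equivExterior Q) (CliffordAlgebra.ι Q (e a) * (CliffordAlgebra.ι Q (e b) *
      (CliffordAlgebra.ι Q (e c) * CliffordAlgebra.ι Q (e d)))) =
      (exteriorPower.ιMulti ℝ 4 ![e a, e b, e c, e d] : ExteriorAlgebra ℝ V) := by
    simp only [CliffordAlgebra.equivExterior, CliffordAlgebra.changeFormEquiv_apply,
      CliffordAlgebra.changeForm_ι_mul, CliffordAlgebra.changeForm_ι,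
      CliffordAlgebra.contractLeft_ι_mul, CliffordAlgebra.contractLeft_ι, assoc_Q,
      eta_e _ _ hab, eta_e _ _ hac, eta_e _ _ had, eta_e _ _ hbc, eta_e _ _ hbd, eta_e _ _ hcd,
      map_zero, mul_zero, zero_smul, sub_zero]
    simp [ExteriorAlgebra.ιMulti_apply, ExteriorAlgebra.ι]
  rw [SpinorModule.c4, ← key, LinearEquiv.symm_apply_apply]
  simp [SpinorModule.c, mul_assoc]

theorem form_c (v : V) (s t : S) : P.form (P.c v s) t = - P.form s (P.c v t) := P.form_cl v s t

theorem c4_self (φ : ⋀[ℝ]^4 V) (s t : S) : P.form (P.c4 φ s) t = P.form s (P.c4 φ t) := by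
  have hsp := exteriorPower.ιMulti_family_span_of_span (R := ℝ) (n := 4) (v := e) (by
    rw [eq_top_iff]; intro v _; rw [← sum_e v]
    exact Submodule.sum_mem _ fun i _ => Submodule.smul_mem _ _ (Submodule.subset_span ⟨i, rfl⟩))
  have hφ : φ ∈ Submodule.span ℝ (Set.range (exteriorPower.ιMulti_family ℝ 4 e)) := by
    rw [hsp]; trivial
  induction hφ using Submodule.span_induction with
  | zero => simp [SpinorModule.c4]
  | add x y _ _ hx hy =>
    have h : P.c4 (x + y) = P.c4 x + P.c4 y := by simp only [SpinorModule.c4, Submodule.coe_add, map_add]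
    rw [h]; simp [hx, hy]
  | smul r x _ hx =>
    have h : P.c4 (r • x) = r • P.c4 x := by simp only [SpinorModule.c4, Submodule.coe_smul, map_smul]
    rw [h]; simp [hx]
  | mem x hx =>
    obtain ⟨f, rfl⟩ := hx
    have hne : ∀ i j : Fin 4, i ≠ j → Set.powersetCard.ofFinEmbEquiv.symm f i ≠ Set.powersetCard.ofFinEmbEquiv.symm f j :=
      fun i j h => fun h' => h ((Set.powersetCard.ofFinEmbEquiv.symm f).injective h')
    set g := Set.powersetCard.ofFinEmbEquiv.symm f
    have h : exteriorPower.ιMulti_family ℝ 4 e f = exteriorPower.ιMulti ℝ 4 ![e (g 0), e (g 1), e (g 2), e (g 3)] := by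
      rw [exteriorPower.ιMulti_family]
      congr 1
      funext k; fin_cases k <;> rfl
    rw [h, c4_basis P _ _ _ _ (hne _ _ (by decide)) (hne _ _ (by decide)) (hne _ _ (by decide)) (hne _ _ (by decide)) (hne _ _ (by decide)) (hne _ _ (by decide))]
    have sw : ∀ i j : Fin 4, i ≠ j → ∀ s, P.c (e (g i)) (P.c (e (g j)) s) = - P.c (e (g j)) (P.c (e (g i)) s) := by
      intro i j hij s
      have := clifford P (e (g i)) (e (g j))
      rw [eta_e _ _ (hne i j hij)] at this
      have := congrArg (fun f : Module.End ℝ S => f s) this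
      simp at this
      exact eq_neg_of_add_eq_zero_left this
    simp only [Module.End.mul_apply, form_c, neg_neg]
    rw [sw 3 2 (by decide), sw 3 1 (by decide), sw 3 0 (by decide)]
    simp only [map_neg, neg_neg]
    rw [sw 2 1 (by decide), sw 2 0 (by decide)]
    simp only [map_neg, neg_neg]
    rw [sw 1 0 (by decide)]
    simp only [map_neg, neg_neg]

/-- The values of `γ^φ` lie in `so(V)`. -/
theorem gamma_mem_so (φ : ⋀[ℝ]^4 V) (s t : S) : P.gamma φ s t ∈ so := by
  have h0 : ∀ v, eta (P.gamma φ s t v) v = 0 := by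
    intro v
    have hb : ∀ a b, P.form (P.beta φ v a) (P.c v b) =
        (1/24) * (eta v v * P.form (P.c4 φ a) b - 3 * P.form (P.c4 φ (P.c v a)) (P.c v b)) := by
      intro a b
      have h := congrArg (fun f : Module.End ℝ S => f b) (clifford P v v)
      have h' : P.c v (P.c v b) = (-eta v v) • b := by
        simp at h
        have h2 : (2:ℝ) • P.c v (P.c v b) = (2:ℝ) • ((-eta v v) • b) := by
          rw [two_smul, h]; module
        exact smul_right_injective _ (two_ne_zero) h2
      simp only [SpinorModule.beta, LinearMap.smul_apply, LinearMap.sub_apply, LinearMap.comp_apply,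
        LinearMap.mulRight_apply, LinearMap.mulLeft_apply, Module.End.mul_apply, map_smul, map_sub,
        smul_eq_mul, form_c, h']
      ring
    have : P.gamma φ s t v = -P.kappa (P.beta φ v s) t - P.kappa (P.beta φ v t) s := by
      simp [SpinorModule.gamma]
    rw [this]
    simp only [map_sub, map_neg, LinearMap.sub_apply, LinearMap.neg_apply, eta_kappa, hb]
    have a1 := P.form_alt.neg_eq (P.c4 φ t) s
    have a2 := P.form_alt.neg_eq (P.c4 φ (P.c v t)) (P.c v s)
    rw [c4_self P φ s t, c4_self P φ (P.c v s), ← a1, ← a2]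
    ring
  have hs : ∀ x y, eta x y = eta y x := fun x y => by
    simp only [eta, LinearMap.mk₂_apply]; simp only [mul_comm]
  rw [LinearMap.mem_skewAdjointSubmodule]
  intro x y
  have := h0 (x + y)
  simp only [map_add, LinearMap.add_apply, h0] at this
  change eta (P.gamma φ s t x) y = eta x (-(P.gamma φ s t y))
  rw [map_neg]
  have h2 := hs (P.gamma φ s t y) x
  linarith

/-! ### Existence of the spinor module -/

/-- Bit masks of eleven anticommuting signed permutation matrices of size `32`. -/
def mTab : Fin 11 → ℕ := ![1, 0, 1, 3, 7, 11, 15, 19, 23, 27, 31]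
def zTab : Fin 11 → ℕ := ![1, 1, 2, 0, 6, 14, 26, 30, 18, 22, 10]
def idx (i : Fin 11) (j : Fin 32) : Fin 32 := Fin.ofNat 32 (Nat.xor j.1 (mTab i))
def par (n : ℕ) : Bool := xor (n.testBit 0) (xor (n.testBit 1) (xor (n.testBit 2)
  (xor (n.testBit 3) (n.testBit 4))))
def sg (i : Fin 11) (j : Fin 32) : ℤ := if par (Nat.land j.1 (zTab i)) then -1 else 1

set_option maxRecDepth 100000 in
theorem idx_comm : ∀ i k j, idx k (idx i j) = idx i (idx k j) := by decide
set_option maxRecDepth 100000 in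
theorem idx_idx : ∀ i j, idx i (idx i j) = j := by decide
set_option maxRecDepth 100000 in
theorem sg_anti : ∀ i k, i ≠ k → ∀ j, sg i j * sg k (idx i j) = -(sg k j * sg i (idx k j)) := by
  decide
set_option maxRecDepth 100000 in
theorem sg_sq : ∀ i j, sg i j * sg i (idx i j) = if i = 0 then -1 else 1 := by decide
set_option maxRecDepth 100000 in
theorem sg_mul : ∀ i j, sg i j * sg i j = 1 := by decide

abbrev S0 := Fin 32 → ℝ

/-- The real gamma matrices `(γᵢ s)ⱼ = ± s_{j xor mᵢ}`. -/
def gam (i : Fin 11) : Module.End ℝ S0 where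
  toFun s j := sg i j * s (idx i j)
  map_add' s t := by funext j; simp [mul_add]
  map_smul' r s := by funext j; simp; ring

theorem gam_anti (i k : Fin 11) (h : i ≠ k) : gam i * gam k = -(gam k * gam i) := by
  refine LinearMap.ext fun s => funext fun j => ?_
  have := sg_anti i k h j
  have h' : (sg i j : ℝ) * sg k (idx i j) = -(sg k j * sg i (idx k j)) := by exact_mod_cast this
  simp only [gam, Module.End.mul_apply, LinearMap.coe_mk, AddHom.coe_mk, LinearMap.neg_apply,
    Pi.neg_apply, idx_comm i k j]
  linear_combination s (idx i (idx k j)) * h'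

theorem gam_sq (i : Fin 11) : gam i * gam i = (-sgn i) • 1 := by
  refine LinearMap.ext fun s => funext fun j => ?_
  have := sg_sq i j
  have h' : (sg i j : ℝ) * sg i (idx i j) = if i = 0 then -1 else 1 := by
    have := congrArg (Int.cast (R := ℝ)) this
    push_cast at this; exact this
  simp only [gam, Module.End.mul_apply, LinearMap.coe_mk, AddHom.coe_mk, LinearMap.smul_apply,
    Module.End.one_apply, Pi.smul_apply, smul_eq_mul, idx_idx, ← mul_assoc, h', sgn]
  split_ifs <;> simp

def gamV : V →ₗ[ℝ] Module.End ℝ S0 := ∑ i, (LinearMap.proj i : V →ₗ[ℝ] ℝ).smulRight (gam i)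

theorem gamV_apply (v : V) : gamV v = ∑ i, v i • gam i := by simp [gamV]

theorem gamV_sq (v : V) : gamV v * gamV v = algebraMap ℝ _ (Q v) := by
  have h2 : gamV v * gamV v = ∑ i, ∑ k, (v i * v k) • (gam i * gam k) := by
    simp only [gamV_apply, Finset.sum_mul]
    refine Finset.sum_congr rfl fun i _ => ?_
    rw [Finset.mul_sum]
    exact Finset.sum_congr rfl fun k _ => smul_mul_smul_comm _ _ _ _
  have h3 : (2 : ℝ) • (gamV v * gamV v) =
      ∑ i, ∑ k, (v i * v k) • (gam i * gam k + gam k * gam i) := by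
    simp only [smul_add, Finset.sum_add_distrib]
    rw [two_smul]
    congr 1
    rw [h2, Finset.sum_comm]
    simp only [mul_comm]
  have h4 : ∀ i k, (v i * v k) • (gam i * gam k + gam k * gam i) =
      if k = i then (-2 * (sgn i * (v i * v i))) • (1 : Module.End ℝ S0) else 0 := by
    intro i k
    split_ifs with h
    · subst h; rw [gam_sq]; module
    · rw [gam_anti i k (Ne.symm h)]; simp
  simp only [h4, Finset.sum_ite_eq', Finset.mem_univ, if_true, ← Finset.sum_smul] at h3
  have h5 : (2 : ℝ) • (gamV v * gamV v) = (2 : ℝ) • (algebraMap ℝ (Module.End ℝ S0) (Q v)) := by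
    rw [h3, Q_apply, Algebra.algebraMap_eq_smul_one, ← Finset.mul_sum]; module
  exact smul_right_injective _ (two_ne_zero) h5

def form0 : LinearMap.BilinForm ℝ S0 :=
  LinearMap.mk₂ ℝ (fun s t => s ⬝ᵥ gam 0 t)
    (fun s s' t => by simp [add_dotProduct])
    (fun r s t => by simp)
    (fun s t t' => by simp)
    (fun r s t => by simp)

theorem dot_gam (i : Fin 11) (s t : S0) :
    gam i s ⬝ᵥ t = (-sgn i) * (s ⬝ᵥ gam i t) := by
  let f : Fin 32 ≃ Fin 32 := ⟨idx i, idx i, idx_idx i, idx_idx i⟩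
  have h : gam i s ⬝ᵥ t = ∑ j, gam i s (f j) * t (f j) := (Equiv.sum_comp f _).symm
  rw [h, dotProduct, Finset.mul_sum]
  refine Finset.sum_congr rfl fun j _ => ?_
  have a1 : (sg i j : ℝ) * sg i (idx i j) = -sgn i := by
    have := congrArg (Int.cast (R := ℝ)) (sg_sq i j)
    push_cast at this; rw [this, sgn]; split_ifs <;> simp
  have a2 : (sg i j : ℝ) * sg i j = 1 := by exact_mod_cast sg_mul i j
  change (sg i (idx i j) : ℝ) * s (idx i (idx i j)) * t (idx i j) = -sgn i * (s j * (sg i j * t (idx i j)))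
  rw [idx_idx]
  linear_combination (-(sg i (idx i j) : ℝ) * s j * t (idx i j)) * a2 + s j * t (idx i j) * sg i j * a1

/-- The spinor module exists, on `ℝ³²`. -/
theorem nonempty_spinorModule : Nonempty (SpinorModule S0) := by
  have sg0 : sgn 0 = 1 := by simp [sgn]
  have g0 : ∀ s, gam 0 (gam 0 s) = -s := fun s => by
    have := congrArg (fun f : Module.End ℝ S0 => f s) (gam_sq 0)
    simpa [sg0] using this
  have skew : ∀ s t, s ⬝ᵥ gam 0 t = -(t ⬝ᵥ gam 0 s) := fun s t => by
    rw [dotProduct_comm, dot_gam, sg0]; ring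
  refine ⟨⟨by simp, CliffordAlgebra.lift Q ⟨gamV, gamV_sq⟩, form0, ?_, ?_, ?_⟩⟩
  · intro s
    have := skew s s
    change s ⬝ᵥ gam 0 s = 0
    linarith
  · have hh : ∀ s : S0, (∀ t, form0 s t = 0) → s = 0 := by
      intro s h
      have := h (gam 0 s)
      change s ⬝ᵥ gam 0 (gam 0 s) = 0 at this
      rw [g0] at this
      simpa using this
    refine ⟨hh, fun s h => hh s fun t => ?_⟩
    have := h t
    change t ⬝ᵥ gam 0 s = 0 at this
    change s ⬝ᵥ gam 0 t = 0
    rw [skew, this, neg_zero]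
  · intro v s t
    simp only [CliffordAlgebra.lift_ι_apply]
    change gamV v s ⬝ᵥ gam 0 t = -(s ⬝ᵥ gam 0 (gamV v t))
    simp only [gamV_apply, LinearMap.sum_apply, LinearMap.smul_apply, map_sum, map_smul,
      sum_dotProduct, dotProduct_sum, smul_dotProduct, dotProduct_smul, ← Finset.sum_neg_distrib]
    refine Finset.sum_congr rfl fun i _ => ?_
    rw [dot_gam]
    rcases eq_or_ne i 0 with rfl | h
    · rw [sg0]; simp
    · have := congrArg (fun f : Module.End ℝ S0 => f t) (gam_anti i 0 h)
      simp only [Module.End.mul_apply, LinearMap.neg_apply] at this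
      rw [this]; simp [sgn, h]

end

end Sugra

/-!
The `so(V)`-equivariance of everything in sight reduces the theorem to a computation in the Lie
algebra of endomorphisms of `S`, carried out on the subspace `S'`.

* `σ` is a Lie algebra homomorphism on `so(V)` (`sigma_lie`), the Dirac current is equivariant
  (`map_kappa`), and so is Clifford multiplication by four-vectors (`sigma_c4`), because on
  decomposables it is the antisymmetrized Clifford product. Hence the stabilizer of `φ` annihilates
  `β^φ` (`actBeta_eq_zero`), and `γ^φ` is equivariant under it.
* Since the Dirac current maps `⊙² S'` onto `V`, an element of `so(V)` whose spin action kills `S'`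
  is zero (`SpinorModule.IsSection.eq_zero_of_sigma`).

An element of `so(V)` is in the isotropy algebra `h` as soon as it is `γ^φ(ω)` with `ω ∈ ⊙² S'` and
`κ(ω) = 0`. The first three conclusions exhibit such `ω`, respectively `A · Σ(v) - Σ(A v)`,
`s ⊗ s - Σ(κ(s,s))` and `D_v · Σ(w) - Σ(X_v w - X_w v)`, where `D_v = β_v + σ(X_v)` preserves `S'`.
In the last case the equation for `R(v, κ(s,s))` computes `γ^φ`.

The equivariance of `R` follows from the equation for `σ(R(v,w))`, whose right-hand side is
equivariant by the first conclusion, and faithfulness. The algebraic Bianchi identity is checked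
with one argument equal to `κ(s,s)`, where the two equations for `R` cancel. Finally, on `S'` one has
`[D_v, D_w] = D_{X_v w - X_w v} + σ(ρ(v,w))` with `ρ` the `h`-valued map of the third conclusion; the
Jacobi identity for `D_u, D_v, D_w`, the algebraic Bianchi identity and faithfulness give the
differential Bianchi identity.
-/

namespace Sugra

variable {S : Type*} [AddCommGroup S] [Module ℝ S] (P : SpinorModule S)

/-! ### The spinor representation and the Dirac current -/

theorem eta_comm (x y : V) : eta x y = eta y x := by
  simp only [eta, LinearMap.mk₂_apply, mul_comm]

theorem sgn_mul_self (i : Fin 11) : sgn i * sgn i = 1 := by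
  unfold sgn; split_ifs <;> norm_num

theorem eta_left_injective {x y : V} (h : ∀ v, eta x v = eta y v) : x = y := by
  funext i
  have := h (e i)
  rw [eta_comm x, eta_comm y, eta_e_left, eta_e_left] at this
  linear_combination sgn i * this + (y i - x i) * sgn_mul_self i

theorem mem_so_iff {A : Module.End ℝ V} : A ∈ so ↔ ∀ x y, eta (A x) y = -eta x (A y) := by
  rw [LinearMap.mem_skewAdjointSubmodule]
  refine forall₂_congr fun x y => ?_
  simp

theorem lie_mem_so {A B : Module.End ℝ V} (hA : A ∈ so) (hB : B ∈ so) : ⁅A, B⁆ ∈ so := by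
  rw [mem_so_iff] at *
  intro x y
  simp only [LieRing.of_associative_ring_bracket, LinearMap.sub_apply, Module.End.mul_apply,
    map_sub, hA, hB]
  ring

theorem form_sigma {A : Module.End ℝ V} (hA : A ∈ so) (s t : S) :
    P.form (P.sigma A s) t = -P.form s (P.sigma A t) := by
  have h : ∀ i, P.c (A (e i)) * P.c (e i) = -(P.c (e i) * P.c (A (e i))) := by
    intro i
    have h0 : eta (A (e i)) (e i) = 0 := by
      have := mem_so_iff.1 hA (e i) (e i)
      rw [eta_comm (e i)] at this
      linarith
    have := clifford P (A (e i)) (e i)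
    rw [h0, mul_zero, zero_smul] at this
    exact eq_neg_of_add_eq_zero_left this
  have h' : ∀ i t, P.c (A (e i)) (P.c (e i) t) = -P.c (e i) (P.c (A (e i)) t) := fun i t =>
    LinearMap.congr_fun (h i) t
  simp only [SpinorModule.sigma, LinearMap.coe_mk, AddHom.coe_mk, LinearMap.smul_apply,
    LinearMap.sum_apply, Module.End.mul_apply, map_smul, map_sum, form_c, smul_eq_mul, h', neg_neg,
    mul_neg, map_neg, Finset.sum_neg_distrib]

theorem sigma_apply_c {A : Module.End ℝ V} (hA : A ∈ so) (v : V) (s : S) :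
    P.sigma A (P.c v s) = P.c v (P.sigma A s) + P.c (A v) s := by
  have := LinearMap.congr_fun (sigma_comm P A hA v) s
  simp only [LinearMap.sub_apply, Module.End.mul_apply] at this
  rw [← this]; abel

theorem kappa_comm (s t : S) : P.kappa s t = P.kappa t s := by
  refine eta_left_injective fun v => ?_
  rw [eta_kappa, eta_kappa, ← P.form_alt.neg_eq, form_c, neg_neg]

/-- The Dirac current is `so(V)`-equivariant. -/
theorem map_kappa {A : Module.End ℝ V} (hA : A ∈ so) (s t : S) :
    A (P.kappa s t) = P.kappa (P.sigma A s) t + P.kappa s (P.sigma A t) := by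
  refine eta_left_injective fun v => ?_
  rw [mem_so_iff.1 hA, map_add, LinearMap.add_apply, eta_kappa, eta_kappa, eta_kappa,
    form_sigma P hA, sigma_apply_c P hA, map_add]
  ring

/-- Moving `A` from one leg of the invariant tensor `∑ᵢ η(eᵢ,eᵢ) eᵢ ⊗ eᵢ` to the other. -/
theorem sum_c_so {A B : Module.End ℝ V} (hA : A ∈ so) :
    ∑ i, sgn i • (P.c (A (e i)) * P.c (B (e i))) =
      -∑ i, sgn i • (P.c (e i) * P.c (B (A (e i)))) := by
  have hcoef : ∀ i j, sgn i * A (e i) j = -(sgn j * A (e j) i) := by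
    intro i j
    have h := mem_so_iff.1 hA (e i) (e j)
    rw [eta_comm, eta_e_left, eta_e_left] at h
    linear_combination sgn i * sgn j * h - sgn i * A (e i) j * sgn_mul_self j
      - sgn j * A (e j) i * sgn_mul_self i
  have h1 : ∀ i, sgn i • (P.c (A (e i)) * P.c (B (e i))) =
      ∑ j, (sgn i * A (e i) j) • (P.c (e j) * P.c (B (e i))) := by
    intro i
    conv_lhs => rw [← sum_e (A (e i))]
    simp only [map_sum, map_smul, Finset.sum_mul, smul_mul_assoc, Finset.smul_sum, smul_smul]
  have h2 : ∀ j, sgn j • (P.c (e j) * P.c (B (A (e j)))) =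
      ∑ i, (sgn j * A (e j) i) • (P.c (e j) * P.c (B (e i))) := by
    intro j
    conv_lhs => rw [← sum_e (A (e j))]
    simp only [map_sum, map_smul, Finset.mul_sum, mul_smul_comm, Finset.smul_sum, smul_smul]
  simp only [h1, h2, ← Finset.sum_neg_distrib, ← neg_smul]
  rw [Finset.sum_comm]
  exact Finset.sum_congr rfl fun j _ => Finset.sum_congr rfl fun i _ => by rw [hcoef]

theorem sigma_lie {A B : Module.End ℝ V} (hA : A ∈ so) :
    P.sigma ⁅A, B⁆ = ⁅P.sigma A, P.sigma B⁆ := by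
  have hprod : ∀ i, P.sigma A * (P.c (e i) * P.c (B (e i))) -
      P.c (e i) * P.c (B (e i)) * P.sigma A =
      P.c (A (e i)) * P.c (B (e i)) + P.c (e i) * P.c (A (B (e i))) := by
    intro i
    rw [← sigma_comm P A hA, ← sigma_comm P A hA]
    noncomm_ring
  have hB : ∀ C, P.sigma C = (1 / 4 : ℝ) • ∑ i, sgn i • (P.c (e i) * P.c (C (e i))) :=
    fun _ => rfl
  rw [LieRing.of_associative_ring_bracket, LieRing.of_associative_ring_bracket, hB B, hB (_ - _)]
  simp only [mul_smul_comm, smul_mul_assoc, ← smul_sub, Finset.mul_sum, Finset.sum_mul,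
    ← Finset.sum_sub_distrib, hprod]
  simp only [smul_add, Finset.sum_add_distrib, sum_c_so P hA, LinearMap.sub_apply,
    Module.End.mul_apply, map_sub, mul_sub, smul_sub, Finset.sum_sub_distrib]
  module

/-! ### Equivariance of Clifford multiplication by four-vectors -/

/-- The Clifford product `(v₁, …, v₄) ↦ v₁ · v₂ · v₃ · v₄` as an operator on spinors. -/
noncomputable def cliffordProd : MultilinearMap ℝ (fun _ : Fin 4 => V) (Module.End ℝ S) :=
  (MultilinearMap.mkPiAlgebraFin ℝ 4 (Module.End ℝ S)).compLinearMap fun _ => P.c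

theorem cliffordProd_apply (v : Fin 4 → V) :
    cliffordProd P v = P.c (v 0) * P.c (v 1) * P.c (v 2) * P.c (v 3) := by
  simp [cliffordProd, List.ofFn_succ, mul_assoc]

/-- Distinct basis vectors anticommute, so permuting them in a Clifford product costs the sign of the
permutation; it suffices to treat the adjacent transpositions, which generate. -/
theorem cliffordProd_basis_perm (π : Equiv.Perm (Fin 4)) :
    ∀ a : Fin 4 → Fin 11, Function.Injective a →
      cliffordProd P (fun k => e (a (π k))) =
        Equiv.Perm.sign π • cliffordProd P (fun k => e (a k)) := by
  have hswap : ∀ i j : Fin 11, i ≠ j → P.c (e i) * P.c (e j) = -(P.c (e j) * P.c (e i)) := by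
    intro i j hij
    have := clifford P (e i) (e j)
    rw [eta_e _ _ hij, mul_zero, zero_smul] at this
    exact eq_neg_of_add_eq_zero_left this
  have hmem : π ∈ Submonoid.closure
      (Set.range fun i : Fin 3 => Equiv.swap i.castSucc i.succ) := by
    rw [Equiv.Perm.mclosure_swap_castSucc_succ]; trivial
  induction hmem using Submonoid.closure_induction with
  | one => intro a _; simp
  | mul π ρ _ _ hπ hρ =>
    intro a ha
    have := hρ (a ∘ π) (ha.comp π.injective)
    simp only [Function.comp_apply] at this
    simp only [Equiv.Perm.coe_mul, Function.comp_apply, this, hπ a ha, Equiv.Perm.sign_mul, smul_smul,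
      mul_comm]
  | mem τ hτ =>
    obtain ⟨i, rfl⟩ := hτ
    intro a ha
    have hs : Equiv.Perm.sign (Equiv.swap i.castSucc i.succ) = -1 :=
      Equiv.Perm.sign_swap (Fin.castSucc_lt_succ).ne
    rw [hs, cliffordProd_apply, cliffordProd_apply, Units.neg_smul, one_smul]
    have h01 := hswap (a 0) (a 1) (ha.ne (by decide))
    have h12 := hswap (a 1) (a 2) (ha.ne (by decide))
    have h23 := hswap (a 2) (a 3) (ha.ne (by decide))
    fin_cases i
    · change P.c (e (a 1)) * P.c (e (a 0)) * P.c (e (a 2)) * P.c (e (a 3)) = _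
      rw [h01]; simp
    · change P.c (e (a 0)) * P.c (e (a 2)) * P.c (e (a 1)) * P.c (e (a 3)) = _
      rw [mul_assoc (P.c (e (a 0))) (P.c (e (a 1))), h12]; simp [mul_assoc]
    · change P.c (e (a 0)) * P.c (e (a 1)) * P.c (e (a 3)) * P.c (e (a 2)) = _
      rw [mul_assoc _ (P.c (e (a 2))), h23]; simp [mul_assoc]

/-- `c4` as a linear map. -/
noncomputable def c4Hom : ⋀[ℝ]^4 V →ₗ[ℝ] Module.End ℝ S :=
  P.cl.toLinearMap ∘ₗ (CliffordAlgebra.equivExterior Q).symm.toLinearMap ∘ₗ Submodule.subtype _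

theorem c4Hom_apply (φ : ⋀[ℝ]^4 V) : c4Hom P φ = P.c4 φ := rfl

/-- On decomposable four-vectors, Clifford multiplication is the antisymmetrized product. -/
theorem c4_ιMulti (v : Fin 4 → V) :
    (24 : ℝ) • P.c4 (exteriorPower.ιMulti ℝ 4 v) =
      ∑ π : Equiv.Perm (Fin 4), Equiv.Perm.sign π • cliffordProd P (v ∘ π) := by
  have h : (24 : ℝ) • (c4Hom P).compAlternatingMap (exteriorPower.ιMulti ℝ 4) =
      MultilinearMap.alternatization (cliffordProd P) := by
    refine Module.Basis.ext_alternating (Pi.basisFun ℝ (Fin 11)) fun a ha => ?_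
    have he : (fun i => (Pi.basisFun ℝ (Fin 11)) (a i)) = fun i => e (a i) := by
      funext i; simp [e]
    rw [he, MultilinearMap.alternatization_apply]
    have hterm : ∀ π : Equiv.Perm (Fin 4), Equiv.Perm.sign π •
        (cliffordProd P).domDomCongr π (fun i => e (a i)) = cliffordProd P fun k => e (a k) := by
      intro π
      rw [MultilinearMap.domDomCongr_apply, cliffordProd_basis_perm P π a ha, smul_smul,
        Int.units_mul_self, one_smul]
    have hl : P.c4 (exteriorPower.ιMulti ℝ 4 fun i => e (a i)) = cliffordProd P fun k => e (a k) := by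
      have hv : (fun i => e (a i)) = ![e (a 0), e (a 1), e (a 2), e (a 3)] := by
        funext k; fin_cases k <;> rfl
      rw [cliffordProd_apply, hv]
      exact c4_basis P _ _ _ _ (ha.ne (by decide)) (ha.ne (by decide)) (ha.ne (by decide))
        (ha.ne (by decide)) (ha.ne (by decide)) (ha.ne (by decide))
    simp only [hterm, Finset.sum_const, Finset.card_univ, Fintype.card_perm, Fintype.card_fin]
    rw [AlternatingMap.smul_apply, LinearMap.compAlternatingMap_apply, c4Hom_apply, hl,
      ← Nat.cast_smul_eq_nsmul ℝ]
    norm_num [Nat.factorial]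
  have := DFunLike.congr_fun h v
  rw [MultilinearMap.alternatization_apply] at this
  exact this

theorem sigma_cliffordProd {A : Module.End ℝ V} (hA : A ∈ so) (v : Fin 4 → V) :
    P.sigma A * cliffordProd P v - cliffordProd P v * P.sigma A =
      ∑ k, cliffordProd P (Function.update v k (A (v k))) := by
  simp [Fin.sum_univ_four, cliffordProd_apply, Function.update, ← sigma_comm P A hA]
  noncomm_ring

theorem derAlt_apply (n : ℕ) (A : Module.End ℝ V) (v : Fin n → V) :
    derAlt n A v = ∑ k, exteriorPower.ιMulti ℝ n (Function.update v k (A (v k))) := by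
  change (∑ k : Fin n, (exteriorPower.ιMulti ℝ n (M := V)).toMultilinearMap.compLinearMap
      (Function.update (fun _ => LinearMap.id) k A)) v = _
  rw [sum_apply]
  refine Finset.sum_congr rfl fun k _ => ?_
  rw [MultilinearMap.compLinearMap_apply]
  refine congrArg (exteriorPower.ιMulti ℝ n) (funext fun l => ?_)
  rcases eq_or_ne l k with rfl | h <;> simp [*]

/-- Clifford multiplication by four-vectors is `so(V)`-equivariant. -/
theorem sigma_c4 {A : Module.End ℝ V} (hA : A ∈ so) (φ : ⋀[ℝ]^4 V) :
    P.sigma A * P.c4 φ - P.c4 φ * P.sigma A = P.c4 (der 4 A φ) := by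
  have h : (LinearMap.mulLeft ℝ (P.sigma A) - LinearMap.mulRight ℝ (P.sigma A)) ∘ₗ c4Hom P =
      c4Hom P ∘ₗ der 4 A := by
    refine exteriorPower.linearMap_ext (AlternatingMap.ext fun v => ?_)
    simp only [LinearMap.compAlternatingMap_apply, LinearMap.comp_apply, LinearMap.sub_apply,
      LinearMap.mulLeft_apply, LinearMap.mulRight_apply, der,
      exteriorPower.alternatingMapLinearEquiv_apply_ιMulti, derAlt_apply, map_sum, c4Hom_apply]
    refine smul_right_injective _ (show (24 : ℝ) ≠ 0 by norm_num) ?_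
    change (24 : ℝ) • (_ - _) = (24 : ℝ) • _
    rw [smul_sub, ← mul_smul_comm, ← smul_mul_assoc, Finset.smul_sum, c4_ιMulti, Finset.mul_sum,
      Finset.sum_mul, ← Finset.sum_sub_distrib]
    simp only [c4_ιMulti]
    rw [Finset.sum_comm]
    refine Finset.sum_congr rfl fun π _ => ?_
    rw [mul_smul_comm, smul_mul_assoc, ← smul_sub, sigma_cliffordProd P hA, Finset.smul_sum,
      ← Equiv.sum_comp π fun k => Equiv.Perm.sign π •
        cliffordProd P (Function.update v k (A (v k)) ∘ π)]
    refine Finset.sum_congr rfl fun k _ => ?_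
    congr 2
    funext l
    rcases eq_or_ne l k with rfl | hlk
    · simp
    · simp [hlk]
  exact LinearMap.congr_fun h φ

theorem sigma_lie_apply {A B : Module.End ℝ V} (hA : A ∈ so) (s : S) :
    P.sigma ⁅A, B⁆ s = P.sigma A (P.sigma B s) - P.sigma B (P.sigma A s) := by
  rw [sigma_lie P hA]; rfl

/-! ### Equivariance of `β` and `γ` -/

theorem beta_apply (φ : ⋀[ℝ]^4 V) (v : V) :
    P.beta φ v = (1 / 24 : ℝ) • (P.c v * P.c4 φ - (3 : ℝ) • (P.c4 φ * P.c v)) := rfl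

theorem gamma_apply (φ : ⋀[ℝ]^4 V) (s t : S) (v : V) :
    P.gamma φ s t v = -P.kappa (P.beta φ v s) t - P.kappa (P.beta φ v t) s := rfl

theorem gamma_comm (φ : ⋀[ℝ]^4 V) (s t : S) : P.gamma φ s t = P.gamma φ t s := by
  refine LinearMap.ext fun v => ?_
  rw [gamma_apply, gamma_apply]; abel

/-- The stabilizer of `φ` in `so(V)` annihilates `β^φ`. -/
theorem actBeta_eq_zero {φ : ⋀[ℝ]^4 V} {A : Module.End ℝ V} (hA : A ∈ so) (hφ : der 4 A φ = 0)
    (v : V) (s : S) : P.actBeta φ A v s = 0 := by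
  have h4 : P.sigma A * P.c4 φ = P.c4 φ * P.sigma A := by
    have := sigma_c4 P hA φ
    rw [hφ, ← c4Hom_apply P 0, map_zero] at this
    exact sub_eq_zero.1 this
  have hv := sigma_comm P A hA v
  have h : P.sigma A * P.beta φ v - P.beta φ (A v) - P.beta φ v * P.sigma A = 0 := by
    simp only [beta_apply, ← hv, mul_sub, sub_mul, mul_smul_comm, smul_mul_assoc, ← mul_assoc, h4]
    rw [mul_assoc (P.c v) (P.c4 φ) (P.sigma A), ← h4]
    simp only [mul_assoc, h4]
    module
  exact LinearMap.congr_fun h s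

/-- The failure of `γ^φ` to be equivariant under `A ∈ so(V)` is governed by `A · β^φ`. -/
theorem lie_gamma_apply {A : Module.End ℝ V} (hA : A ∈ so) (φ : ⋀[ℝ]^4 V) (s t : S) (w : V) :
    ⁅A, P.gamma φ s t⁆ w = P.gamma φ (P.sigma A s) t w + P.gamma φ s (P.sigma A t) w
      - P.kappa (P.actBeta φ A w s) t - P.kappa (P.actBeta φ A w t) s := by
  simp only [LieRing.of_associative_ring_bracket, LinearMap.sub_apply, Module.End.mul_apply,
    gamma_apply, SpinorModule.actBeta, map_sub, map_neg, map_kappa P hA]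
  abel

/-! ### Bispinors and the isotropy algebra -/

/-- The action of an endomorphism of `S` on `S ⊗ S` as a derivation. -/
noncomputable def tensorDer (T : Module.End ℝ S) : Module.End ℝ (S ⊗[ℝ] S) :=
  T.rTensor S + T.lTensor S

theorem tensorDer_tmul (T : Module.End ℝ S) (s t : S) :
    tensorDer T (s ⊗ₜ[ℝ] t) = T s ⊗ₜ[ℝ] t + s ⊗ₜ[ℝ] T t := by
  simp [tensorDer]

theorem kappa₂_tmul (s t : S) : P.kappa₂ (s ⊗ₜ[ℝ] t) = P.kappa s t := by
  simp [SpinorModule.kappa₂]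

theorem gamma₂_tmul (φ : ⋀[ℝ]^4 V) (s t : S) :
    P.gamma₂ φ (s ⊗ₜ[ℝ] t) = P.gamma φ s t := by
  simp [SpinorModule.gamma₂]

theorem tmul_self_mem_symSq {S' : Submodule ℝ S} {s : S} (hs : s ∈ S') :
    s ⊗ₜ[ℝ] s ∈ SpinorModule.symSq S' :=
  Submodule.subset_span ⟨s, hs, rfl⟩

/-- Linear maps that agree on squares of elements of `S'` agree on `⊙² S'`. -/
theorem eq_of_mem_symSq {S' : Submodule ℝ S} {W : Type*} [AddCommGroup W] [Module ℝ W]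
    {f g : S ⊗[ℝ] S →ₗ[ℝ] W} (h : ∀ s ∈ S', f (s ⊗ₜ[ℝ] s) = g (s ⊗ₜ[ℝ] s)) {ω : S ⊗[ℝ] S}
    (hω : ω ∈ SpinorModule.symSq S') : f ω = g ω :=
  LinearMap.eqOn_span (by rintro _ ⟨s, hs, rfl⟩; exact h s hs) hω

theorem tensorDer_mem_symSq {S' : Submodule ℝ S} {T : Module.End ℝ S} (hT : ∀ s ∈ S', T s ∈ S')
    {ω : S ⊗[ℝ] S} (hω : ω ∈ SpinorModule.symSq S') :
    tensorDer T ω ∈ SpinorModule.symSq S' := by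
  have hle : SpinorModule.symSq S' ≤ (SpinorModule.symSq S').comap (tensorDer T) := by
    refine Submodule.span_le.2 ?_
    rintro _ ⟨s, hs, rfl⟩
    -- polarization
    have h : tensorDer T (s ⊗ₜ[ℝ] s) = (s + T s) ⊗ₜ[ℝ] (s + T s) - s ⊗ₜ[ℝ] s - T s ⊗ₜ[ℝ] T s := by
      rw [tensorDer_tmul, TensorProduct.add_tmul, TensorProduct.tmul_add, TensorProduct.tmul_add]
      abel
    change tensorDer T (s ⊗ₜ[ℝ] s) ∈ SpinorModule.symSq S'
    rw [h]
    exact sub_mem (sub_mem (tmul_self_mem_symSq (add_mem hs (hT s hs))) (tmul_self_mem_symSq hs))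
      (tmul_self_mem_symSq (hT s hs))
  exact hle hω

theorem gamma₂_mem_so (φ : ⋀[ℝ]^4 V) (ω : S ⊗[ℝ] S) : P.gamma₂ φ ω ∈ so := by
  induction ω with
  | zero => rw [map_zero]; exact zero_mem _
  | tmul s t => rw [gamma₂_tmul]; exact gamma_mem_so P φ s t
  | add x y hx hy => rw [map_add]; exact add_mem hx hy

theorem isotropy_le_so (φ : ⋀[ℝ]^4 V) (S' : Submodule ℝ S) : P.isotropy φ S' ≤ so := by
  rintro _ ⟨ω, -, rfl⟩
  exact gamma₂_mem_so P φ ω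

theorem gamma₂_mem_isotropy {φ : ⋀[ℝ]^4 V} {S' : Submodule ℝ S} {ω : S ⊗[ℝ] S}
    (hω : ω ∈ SpinorModule.symSq S') (h : P.kappa₂ ω = 0) : P.gamma₂ φ ω ∈ P.isotropy φ S' :=
  ⟨ω, ⟨hω, h⟩, rfl⟩

theorem kappa₂_tensorDer_sigma {A : Module.End ℝ V} (hA : A ∈ so) (ω : S ⊗[ℝ] S) :
    P.kappa₂ (tensorDer (P.sigma A) ω) = A (P.kappa₂ ω) := by
  have h : P.kappa₂ ∘ₗ tensorDer (P.sigma A) = A ∘ₗ P.kappa₂ :=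
    TensorProduct.ext' fun s t => by
      simp only [LinearMap.comp_apply, tensorDer_tmul, map_add, kappa₂_tmul, map_kappa P hA]
  exact LinearMap.congr_fun h ω

theorem gamma₂_tensorDer_sigma {φ : ⋀[ℝ]^4 V} {A : Module.End ℝ V} (hA : A ∈ so)
    (hφ : der 4 A φ = 0) (ω : S ⊗[ℝ] S) :
    P.gamma₂ φ (tensorDer (P.sigma A) ω) = ⁅A, P.gamma₂ φ ω⁆ := by
  have h : P.gamma₂ φ ∘ₗ tensorDer (P.sigma A) =
      (LinearMap.mulLeft ℝ A - LinearMap.mulRight ℝ A) ∘ₗ P.gamma₂ φ :=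
    TensorProduct.ext' fun s t => LinearMap.ext fun w => by
      have := lie_gamma_apply P hA φ s t w
      simp only [actBeta_eq_zero P hA hφ, map_zero, LinearMap.zero_apply, sub_zero] at this
      simp only [LinearMap.comp_apply, tensorDer_tmul, map_add, gamma₂_tmul, LinearMap.add_apply,
        ← this]
      rfl
  exact LinearMap.congr_fun h ω

theorem kappa₂_tensorDer_beta (φ : ⋀[ℝ]^4 V) {S' : Submodule ℝ S} (v : V) {ω : S ⊗[ℝ] S}
    (hω : ω ∈ SpinorModule.symSq S') :
    P.kappa₂ (tensorDer (P.beta φ v) ω) = -P.gamma₂ φ ω v := by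
  refine eq_of_mem_symSq (f := P.kappa₂ ∘ₗ tensorDer (P.beta φ v))
    (g := -(LinearMap.applyₗ v ∘ₗ P.gamma₂ φ)) (fun s _ => ?_) hω
  simp only [LinearMap.comp_apply, tensorDer_tmul, map_add, kappa₂_tmul, LinearMap.neg_apply,
    gamma₂_tmul, LinearMap.applyₗ_apply_apply, gamma_apply, kappa_comm P s]
  abel

/-! ### Consequences of the existence of a section -/

section Homogeneous

variable {P} {S' : Submodule ℝ S} {Sec : V →ₗ[ℝ] S ⊗[ℝ] S}

/-- If the Dirac current has a section, its values `κ(s,s)` with `s ∈ S'` span `V`. -/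
theorem SpinorModule.IsSection.ext_kappa (hSec : P.IsSection S' Sec) {W : Type*} [AddCommGroup W]
    [Module ℝ W] {f g : V →ₗ[ℝ] W} (h : ∀ s ∈ S', f (P.kappa s s) = g (P.kappa s s)) : f = g := by
  refine LinearMap.ext fun v => ?_
  rw [← (hSec v).2]
  refine eq_of_mem_symSq (f := f ∘ₗ P.kappa₂) (g := g ∘ₗ P.kappa₂) (fun s hs => ?_) (hSec v).1
  simpa only [LinearMap.comp_apply, kappa₂_tmul] using h s hs

/-- If the Dirac current has a section, `so(V)` acts faithfully on `S'`. -/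
theorem SpinorModule.IsSection.eq_zero_of_sigma (hSec : P.IsSection S' Sec) {A : Module.End ℝ V}
    (hA : A ∈ so) (h : ∀ s ∈ S', P.sigma A s = 0) : A = 0 :=
  hSec.ext_kappa fun s hs => by rw [map_kappa P hA, h s hs]; simp

end Homogeneous

/-! ### Bivectors -/

theorem wedge_swap (v w : V) : wedge w v = -wedge v w := by
  have := (exteriorPower.ιMulti ℝ 2 (M := V)).map_swap ![v, w] (show (0 : Fin 2) ≠ 1 by decide)
  have h : (![v, w] ∘ Equiv.swap (0 : Fin 2) 1) = ![w, v] := by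
    funext k; fin_cases k <;> rfl
  rwa [h] at this

/-- `w ↦ v ∧ w` as a linear map. -/
noncomputable def wedgeHom (v : V) : V →ₗ[ℝ] ⋀[ℝ]^2 V where
  toFun w := wedge v w
  map_add' x y := by
    have h : ∀ z, Function.update ![v, 0] 1 z = ![v, z] := fun z => by
      funext k; fin_cases k <;> rfl
    have := (exteriorPower.ιMulti ℝ 2 (M := V)).map_update_add ![v, 0] 1 x y
    rwa [h, h, h] at this
  map_smul' r x := by
    have h : ∀ z, Function.update ![v, 0] 1 z = ![v, z] := fun z => by
      funext k; fin_cases k <;> rfl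
    have := (exteriorPower.ιMulti ℝ 2 (M := V)).map_update_smul ![v, 0] 1 r x
    rwa [h, h] at this

theorem wedgeHom_apply (v w : V) : wedgeHom v w = wedge v w := rfl

theorem wedge_sub (u v w : V) : wedge u (v - w) = wedge u v - wedge u w :=
  map_sub (wedgeHom u) v w

/-! ### The operators `β_v + σ(X_v)` -/

section

variable {P} {φ : ⋀[ℝ]^4 V}
  {S' : Submodule ℝ S} {Sec : V →ₗ[ℝ] S ⊗[ℝ] S} {X : V →ₗ[ℝ] Module.End ℝ V}
  {R : ⋀[ℝ]^2 V →ₗ[ℝ] so}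

/-- The map `(v, w) ↦ X_v w - X_w v`, the torsion of `X` up to sign. -/
noncomputable def torsion (X : V →ₗ[ℝ] Module.End ℝ V) (v w : V) : V := X v w - X w v

/-- The `so(V)`-valued map `(v, w) ↦ [X_v, X_w] - X_{X_v w - X_w v} + R(v,w)`. On `S'`, the
commutator `[D_v, D_w]` is `D_{X_v w - X_w v}` plus the spin action of this map, see `conn_comm`. -/
noncomputable def isotropyCurv (X : V →ₗ[ℝ] Module.End ℝ V) (R : ⋀[ℝ]^2 V →ₗ[ℝ] so) (v w : V) :
    Module.End ℝ V :=
  ⁅X v, X w⁆ - X (torsion X v w) + R (wedge v w)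

/-- The endomorphism `D_v = β^φ_v + σ(X_v)` of the spinor module. -/
noncomputable def SpinorModule.conn (P : SpinorModule S) (φ : ⋀[ℝ]^4 V)
    (X : V →ₗ[ℝ] Module.End ℝ V) : V →ₗ[ℝ] Module.End ℝ S :=
  P.beta φ + P.sigma ∘ₗ X

theorem conn_apply (v : V) (s : S) : P.conn φ X v s = P.beta φ v s + P.sigma (X v) s := rfl

/-! ### Elements of the isotropy algebra -/

theorem actBeta_of_mem_isotropy (hLie : P.IsLiePair φ S') {A : Module.End ℝ V}
    (hA : A ∈ P.isotropy φ S') (v : V) (s : S) : P.actBeta φ A v s = 0 :=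
  actBeta_eq_zero P (isotropy_le_so P φ S' hA) (hLie A hA).1 v s

theorem lie_sub_mem_isotropy (hLie : P.IsLiePair φ S') (hSec : P.IsSection S' Sec)
    (hX : X = P.gamma₂ φ ∘ₗ Sec) {A : Module.End ℝ V} (hA : A ∈ P.isotropy φ S') (v : V) :
    ⁅A, X v⁆ - X (A v) ∈ P.isotropy φ S' := by
  have hso := isotropy_le_so P φ S' hA
  have h : ⁅A, X v⁆ - X (A v) = P.gamma₂ φ (tensorDer (P.sigma A) (Sec v) - Sec (A v)) := by
    rw [map_sub, gamma₂_tensorDer_sigma P hso (hLie A hA).1, hX]; rfl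
  rw [h]
  refine gamma₂_mem_isotropy P
    (sub_mem (tensorDer_mem_symSq (hLie A hA).2 (hSec v).1) (hSec (A v)).1) ?_
  rw [map_sub, kappa₂_tensorDer_sigma P hso, (hSec v).2, (hSec (A v)).2, sub_self]

theorem gamma_sub_mem_isotropy (hSec : P.IsSection S' Sec)
    (hX : X = P.gamma₂ φ ∘ₗ Sec) {s : S} (hs : s ∈ S') :
    P.gamma φ s s - X (P.kappa s s) ∈ P.isotropy φ S' := by
  have h : P.gamma φ s s - X (P.kappa s s) =
      P.gamma₂ φ (s ⊗ₜ[ℝ] s - Sec (P.kappa s s)) := by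
    rw [map_sub, gamma₂_tmul, hX]; rfl
  rw [h]
  refine gamma₂_mem_isotropy P (sub_mem (tmul_self_mem_symSq hs) (hSec _).1) ?_
  rw [map_sub, kappa₂_tmul, (hSec _).2, sub_self]

/-- The equation for `R(v, κ(s,s))` says that `γ^φ` intertwines the derivation of `⊙² S'` induced by
`D_v` with `[X_v, γ^φ(-)] + R(v, κ(-))`. -/
theorem gamma₂_tensorDer_conn (hXso : ∀ v, X v ∈ so)
    (hSSV : ∀ s ∈ S', ∀ v w : V,
      (1 / 2 : ℝ) • (R (wedge v (P.kappa s s)) : Module.End ℝ V) w =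
        P.kappa (P.actBeta φ (X v) w s) s + P.gamma φ (P.beta φ v s) s w)
    (v : V) {ω : S ⊗[ℝ] S} (hω : ω ∈ SpinorModule.symSq S') :
    P.gamma₂ φ (tensorDer (P.conn φ X v) ω) =
      ⁅X v, P.gamma₂ φ ω⁆ + R (wedge v (P.kappa₂ ω)) := by
  refine eq_of_mem_symSq (f := P.gamma₂ φ ∘ₗ tensorDer (P.conn φ X v))
    (g := (LinearMap.mulLeft ℝ (X v) - LinearMap.mulRight ℝ (X v)) ∘ₗ P.gamma₂ φ +
      Submodule.subtype so ∘ₗ R ∘ₗ wedgeHom v ∘ₗ P.kappa₂) (fun s hs => ?_) hω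
  refine LinearMap.ext fun w => ?_
  change P.gamma₂ φ (tensorDer (P.conn φ X v) (s ⊗ₜ[ℝ] s)) w =
    ⁅X v, P.gamma₂ φ (s ⊗ₜ[ℝ] s)⁆ w
      + (R (wedge v (P.kappa₂ (s ⊗ₜ[ℝ] s))) : Module.End ℝ V) w
  have hR : (R (wedge v (P.kappa s s)) : Module.End ℝ V) w = (2 : ℝ) •
      (P.kappa (P.actBeta φ (X v) w s) s + P.gamma φ (P.beta φ v s) s w) := by
    rw [← hSSV s hs, smul_smul]; norm_num
  rw [tensorDer_tmul, map_add, gamma₂_tmul, gamma₂_tmul, gamma₂_tmul, kappa₂_tmul, hR,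
    lie_gamma_apply P (hXso v), gamma_comm P φ s, gamma_comm P φ s, conn_apply, map_add]
  simp only [LinearMap.add_apply]
  module

/-- This compares `D_v · Sec w` with `Sec (X_v w - X_w v)`: both elements of `⊙² S'` have Dirac
current `X_v w - X_w v`, and `γ^φ` maps their difference to `isotropyCurv X R v w`. -/
theorem isotropyCurv_mem (hSec : P.IsSection S' Sec) (hX : X = P.gamma₂ φ ∘ₗ Sec)
    (hβ : ∀ v, ∀ s ∈ S', P.beta φ v s + P.sigma (X v) s ∈ S')
    (hSSV : ∀ s ∈ S', ∀ v w : V,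
      (1 / 2 : ℝ) • (R (wedge v (P.kappa s s)) : Module.End ℝ V) w =
        P.kappa (P.actBeta φ (X v) w s) s + P.gamma φ (P.beta φ v s) s w)
    (v w : V) : isotropyCurv X R v w ∈ P.isotropy φ S' := by
  have hXso : ∀ v, X v ∈ so := fun v => by rw [hX]; exact gamma₂_mem_so P φ _
  have hXw : P.gamma₂ φ (Sec w) = X w := by rw [hX]; rfl
  have h : isotropyCurv X R v w =
      P.gamma₂ φ (tensorDer (P.conn φ X v) (Sec w) - Sec (torsion X v w)) := by
    have hXT : P.gamma₂ φ (Sec (torsion X v w)) = X (torsion X v w) :=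
      (LinearMap.congr_fun hX (torsion X v w)).symm
    rw [map_sub, gamma₂_tensorDer_conn hXso hSSV v (hSec w).1, (hSec w).2, hXw, hXT, isotropyCurv]
    abel
  rw [h]
  refine gamma₂_mem_isotropy P (sub_mem (tensorDer_mem_symSq (hβ v) (hSec w).1) (hSec _).1) ?_
  have hsplit : tensorDer (P.conn φ X v) (Sec w) =
      tensorDer (P.beta φ v) (Sec w) + tensorDer (P.sigma (X v)) (Sec w) := by
    simp only [tensorDer, SpinorModule.conn, LinearMap.add_apply, LinearMap.comp_apply,
      LinearMap.rTensor_add, LinearMap.lTensor_add]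
    abel
  rw [map_sub, hsplit, map_add, kappa₂_tensorDer_beta P φ v (hSec w).1,
    kappa₂_tensorDer_sigma P (hXso v), (hSec w).2, (hSec _).2, hXw, torsion]
  abel

/-! ### Equivariance and the algebraic Bianchi identity -/

theorem actCurv_eq_zero (hLie : P.IsLiePair φ S') (hSec : P.IsSection S' Sec)
    (hX : X = P.gamma₂ φ ∘ₗ Sec)
    (hSVV : ∀ s ∈ S', ∀ v w : V,
      P.sigma (R (wedge v w)) s =
        P.actBeta φ (X v) w s - P.actBeta φ (X w) v s + ⁅P.beta φ v, P.beta φ w⁆ s)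
    {A : Module.End ℝ V} (hA : A ∈ P.isotropy φ S') (v w : V) : actCurv A R v w = 0 := by
  have hso := isotropy_le_so P φ S' hA
  refine hSec.eq_zero_of_sigma (sub_mem (sub_mem (lie_mem_so hso (R _).2) (R _).2) (R _).2)
    fun s hs => ?_
  -- Both `A` and `[A, X_v] - X_{Av}` lie in the isotropy algebra, hence annihilate `β`; so the
  -- right-hand side of the equation for `σ(R(v,w))` is `A`-equivariant.
  have hAβ : ∀ v s, P.sigma A (P.beta φ v s) = P.beta φ (A v) s + P.beta φ v (P.sigma A s) :=
    fun v s => by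
      have := actBeta_of_mem_isotropy hLie hA v s
      rw [SpinorModule.actBeta, sub_sub] at this
      exact sub_eq_zero.1 this
  have hXβ : ∀ v w s, P.sigma A (P.actBeta φ (X v) w s) = P.actBeta φ (X (A v)) w s +
      P.actBeta φ (X v) (A w) s + P.actBeta φ (X v) w (P.sigma A s) := by
    intro v w s
    have h := actBeta_of_mem_isotropy hLie (lie_sub_mem_isotropy hLie hSec hX hA v) w s
    simp only [SpinorModule.actBeta, map_sub, sigma_lie_apply P hso, LinearMap.sub_apply, hAβ]
      at h ⊢
    rw [← sub_eq_zero, ← h]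
    simp only [map_add]
    have hl : ⁅A, X v⁆ w = A (X v w) - X v (A w) := rfl
    rw [hl, map_sub, LinearMap.sub_apply]
    abel
  have hσs := (hLie A hA).2 s hs
  simp only [actCurv, map_sub, sigma_lie_apply P hso, LinearMap.sub_apply, hSVV s hs, hSVV _ hσs]
  simp only [LieRing.of_associative_ring_bracket, LinearMap.sub_apply, Module.End.mul_apply,
    map_sub, map_add, hAβ, hXβ]
  abel

/-- The algebraic Bianchi identity; it suffices to test it on the values of the Dirac current. -/
theorem bianchi_algebraic (hSec : P.IsSection S' Sec)
    (hSSV : ∀ s ∈ S', ∀ v w : V,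
      (1 / 2 : ℝ) • (R (wedge v (P.kappa s s)) : Module.End ℝ V) w =
        P.kappa (P.actBeta φ (X v) w s) s + P.gamma φ (P.beta φ v s) s w)
    (hSVV : ∀ s ∈ S', ∀ v w : V,
      P.sigma (R (wedge v w)) s =
        P.actBeta φ (X v) w s - P.actBeta φ (X w) v s + ⁅P.beta φ v, P.beta φ w⁆ s)
    (u v w : V) :
    (R (wedge u v) : Module.End ℝ V) w + (R (wedge v w) : Module.End ℝ V) u
      + (R (wedge w u) : Module.End ℝ V) v = 0 := by
  have key : LinearMap.applyₗ v ∘ₗ Submodule.subtype so ∘ₗ R ∘ₗ wedgeHom w -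
      LinearMap.applyₗ w ∘ₗ Submodule.subtype so ∘ₗ R ∘ₗ wedgeHom v +
      (R (wedge v w) : Module.End ℝ V) = 0 := by
    refine hSec.ext_kappa fun s hs => ?_
    change (R (wedge w (P.kappa s s)) : Module.End ℝ V) v -
      (R (wedge v (P.kappa s s)) : Module.End ℝ V) w +
      (R (wedge v w) : Module.End ℝ V) (P.kappa s s) = 0
    have hR : ∀ v w, (R (wedge v (P.kappa s s)) : Module.End ℝ V) w = (2 : ℝ) •
        (P.kappa (P.actBeta φ (X v) w s) s + P.gamma φ (P.beta φ v s) s w) := fun v w => by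
      rw [← hSSV s hs, smul_smul]; norm_num
    rw [hR, hR, map_kappa P (R _).2, kappa_comm P s, hSVV s hs]
    simp only [gamma_apply, LieRing.of_associative_ring_bracket, LinearMap.sub_apply,
      Module.End.mul_apply, map_add, map_sub, LinearMap.add_apply]
    rw [kappa_comm P (P.beta φ v s) (P.beta φ w s)]
    module
  have := LinearMap.congr_fun key u
  simp only [LinearMap.add_apply, LinearMap.sub_apply, LinearMap.comp_apply, wedgeHom_apply,
    LinearMap.applyₗ_apply_apply, Submodule.subtype_apply, LinearMap.zero_apply] at this
  rw [wedge_swap v u, map_neg, Submodule.coe_neg, LinearMap.neg_apply, ← this]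
  abel

/-! ### The differential Bianchi identity -/

theorem conn_comm (hXso : ∀ v, X v ∈ so)
    (hSVV : ∀ s ∈ S', ∀ v w : V,
      P.sigma (R (wedge v w)) s =
        P.actBeta φ (X v) w s - P.actBeta φ (X w) v s + ⁅P.beta φ v, P.beta φ w⁆ s)
    (v w : V) {s : S} (hs : s ∈ S') :
    P.conn φ X v (P.conn φ X w s) - P.conn φ X w (P.conn φ X v s) =
      P.conn φ X (torsion X v w) s + P.sigma (isotropyCurv X R v w) s := by
  simp only [conn_apply, isotropyCurv, map_add, map_sub, LinearMap.add_apply, LinearMap.sub_apply,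
    hSVV s hs, sigma_lie_apply P (hXso v), SpinorModule.actBeta, torsion]
  simp only [LieRing.of_associative_ring_bracket, LinearMap.sub_apply, Module.End.mul_apply]
  abel

theorem conn_sigma_comm (hXso : ∀ v, X v ∈ so) (hLie : P.IsLiePair φ S') {A : Module.End ℝ V}
    (hA : A ∈ P.isotropy φ S') (u : V) (s : S) :
    P.conn φ X u (P.sigma A s) - P.sigma A (P.conn φ X u s) =
      P.sigma ⁅X u, A⁆ s + P.sigma (X (A u)) s - P.conn φ X (A u) s := by
  have := actBeta_of_mem_isotropy hLie hA u s
  rw [SpinorModule.actBeta, sub_sub] at this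
  simp only [conn_apply, map_add, sub_eq_zero.1 this, sigma_lie_apply P (hXso u)]
  abel

/-- The differential Bianchi identity: the Jacobi identity for the operators `D_u, D_v, D_w` on
`S'`. -/
theorem bianchi_differential (hLie : P.IsLiePair φ S') (hSec : P.IsSection S' Sec)
    (hX : X = P.gamma₂ φ ∘ₗ Sec)
    (hβ : ∀ v, ∀ s ∈ S', P.beta φ v s + P.sigma (X v) s ∈ S')
    (hSSV : ∀ s ∈ S', ∀ v w : V,
      (1 / 2 : ℝ) • (R (wedge v (P.kappa s s)) : Module.End ℝ V) w =
        P.kappa (P.actBeta φ (X v) w s) s + P.gamma φ (P.beta φ v s) s w)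
    (hSVV : ∀ s ∈ S', ∀ v w : V,
      P.sigma (R (wedge v w)) s =
        P.actBeta φ (X v) w s - P.actBeta φ (X w) v s + ⁅P.beta φ v, P.beta φ w⁆ s)
    (u v w : V) :
    actCurv (X u) R v w + actCurv (X v) R w u + actCurv (X w) R u v = 0 := by
  have hXso : ∀ v, X v ∈ so := fun v => by rw [hX]; exact gamma₂_mem_so P φ _
  have hmem := isotropyCurv_mem (R := R) hSec hX hβ hSSV
  -- The double commutator `[D_u, [D_v, D_w]]` is `D_q + σ(B)` with the following `q` and `B`.
  let q : V → V → V → V := fun u v w => torsion X u (torsion X v w) - isotropyCurv X R v w u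
  let B : V → V → V → Module.End ℝ V := fun u v w => isotropyCurv X R u (torsion X v w) +
    (⁅X u, isotropyCurv X R v w⁆ + X (isotropyCurv X R v w u))
  have hdouble : ∀ u v w, ∀ s ∈ S',
      P.conn φ X u (P.conn φ X v (P.conn φ X w s) - P.conn φ X w (P.conn φ X v s)) -
        (P.conn φ X v (P.conn φ X w (P.conn φ X u s)) -
          P.conn φ X w (P.conn φ X v (P.conn φ X u s))) =
      P.conn φ X (q u v w) s + P.sigma (B u v w) s := by
    intro u v w s hs
    have h1 := conn_comm hXso hSVV u (torsion X v w) hs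
    have h2 := conn_sigma_comm hXso hLie (hmem v w) u s
    rw [conn_comm hXso hSVV v w hs, conn_comm hXso hSVV v w (s := P.conn φ X u s) (hβ u s hs)]
    simp only [q, B, map_add, map_sub, LinearMap.add_apply, LinearMap.sub_apply]
    rw [sub_eq_iff_eq_add] at h1 h2
    rw [h1, h2]
    abel
  have hq : q u v w + q v w u + q w u v = 0 := by
    have hb := bianchi_algebraic hSec hSSV hSVV u v w
    have : q u v w + q v w u + q w u v = -((R (wedge u v) : Module.End ℝ V) w +
        (R (wedge v w) : Module.End ℝ V) u + (R (wedge w u) : Module.End ℝ V) v) := by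
      simp only [q, isotropyCurv, torsion, LieRing.of_associative_ring_bracket, map_sub,
        LinearMap.add_apply, LinearMap.sub_apply, Module.End.mul_apply]
      abel
    rw [this, hb, neg_zero]
  have hBso : ∀ u v w, B u v w ∈ so := fun u v w =>
    add_mem (isotropy_le_so P φ S' (hmem _ _))
      (add_mem (lie_mem_so (hXso _) (isotropy_le_so P φ S' (hmem _ _))) (hXso _))
  have hB : B u v w + B v w u + B w u v = 0 := by
    refine hSec.eq_zero_of_sigma (add_mem (add_mem (hBso _ _ _) (hBso _ _ _)) (hBso _ _ _))
      fun s hs => ?_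
    have hD : P.conn φ X (q u v w + q v w u + q w u v) s = 0 := by
      rw [hq, map_zero, LinearMap.zero_apply]
    have h1 := hdouble u v w s hs
    have h2 := hdouble v w u s hs
    have h3 := hdouble w u v s hs
    simp only [map_add, LinearMap.add_apply] at hD ⊢
    have hsum := congrArg₂ (· + ·) (congrArg₂ (· + ·) h1 h2) h3
    simp only [map_sub] at hsum
    have hσ : P.sigma (B u v w) s + P.sigma (B v w u) s + P.sigma (B w u v) s =
        (P.conn φ X (q u v w) s + P.sigma (B u v w) s +
          (P.conn φ X (q v w u) s + P.sigma (B v w u) s) +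
          (P.conn φ X (q w u v) s + P.sigma (B w u v) s)) -
        (P.conn φ X (q u v w) s + P.conn φ X (q v w u) s + P.conn φ X (q w u v) s) := by abel
    rw [hσ, hD, ← hsum]
    abel
  have hXq : X (q u v w) + X (q v w u) + X (q w u v) = 0 := by
    rw [← map_add, ← map_add, hq, map_zero]
  have hsum : actCurv (X u) R v w + actCurv (X v) R w u + actCurv (X w) R u v =
      (B u v w + B v w u + B w u v) + (X (q u v w) + X (q v w u) + X (q w u v)) := by
    have ht : ∀ u v w, (R (wedge u (torsion X v w)) : Module.End ℝ V) =
        -R (wedge (X v w) u) - R (wedge u (X w v)) := fun u v w => by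
      rw [torsion, wedge_sub, wedge_swap u (X v w), map_sub, map_neg, Submodule.coe_sub,
        Submodule.coe_neg, neg_neg]
    simp only [B, q, actCurv, isotropyCurv, ht, LieRing.of_associative_ring_bracket, map_sub,
      mul_add, add_mul, mul_sub, sub_mul, mul_assoc]
    abel
  rw [hsum, hB, hXq, add_zero]

end

end Sugra

theorem theorem5p1 {S : Type*} [AddCommGroup S] [Module ℝ S] (P : Sugra.SpinorModule S)
    (φ : ⋀[ℝ]^4 Sugra.V) (S' : Submodule ℝ S) (hdim : 16 < Module.finrank ℝ S')
    (hLie : P.IsLiePair φ S')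
    (Sec : Sugra.V →ₗ[ℝ] S ⊗[ℝ] S) (hSec : P.IsSection S' Sec)
    (X : Sugra.V →ₗ[ℝ] Module.End ℝ Sugra.V) (hX : X = P.gamma₂ φ ∘ₗ Sec)
    (hβ : ∀ (v : Sugra.V), ∀ s ∈ S', P.beta φ v s + P.sigma (X v) s ∈ S')
    (R : ⋀[ℝ]^2 Sugra.V →ₗ[ℝ] Sugra.so)
    (hSSV : ∀ s ∈ S', ∀ v w : Sugra.V,
      (1 / 2 : ℝ) • (R (Sugra.wedge v (P.kappa s s)) : Module.End ℝ Sugra.V) w =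
        P.kappa (P.actBeta φ (X v) w s) s + P.gamma φ (P.beta φ v s) s w)
    (hSVV : ∀ s ∈ S', ∀ v w : Sugra.V,
      P.sigma (R (Sugra.wedge v w)) s =
        P.actBeta φ (X v) w s - P.actBeta φ (X w) v s + ⁅P.beta φ v, P.beta φ w⁆ s) :
    (∀ A ∈ P.isotropy φ S', ∀ v : Sugra.V, ⁅A, X v⁆ - X (A v) ∈ P.isotropy φ S') ∧
    (∀ s ∈ S', P.gamma φ s s - X (P.kappa s s) ∈ P.isotropy φ S') ∧
    (∀ v w : Sugra.V, ⁅X v, X w⁆ - X (X v w - X w v) + R (Sugra.wedge v w)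
      ∈ P.isotropy φ S') ∧
    (∀ A ∈ P.isotropy φ S', ∀ v w : Sugra.V, Sugra.actCurv A R v w = 0) ∧
    (∀ u v w : Sugra.V,
      (R (Sugra.wedge u v) : Module.End ℝ Sugra.V) w + (R (Sugra.wedge v w) : Module.End ℝ Sugra.V) u
        + (R (Sugra.wedge w u) : Module.End ℝ Sugra.V) v = 0) ∧
    (∀ u v w : Sugra.V, Sugra.actCurv (X u) R v w + Sugra.actCurv (X v) R w u
        + Sugra.actCurv (X w) R u v = 0) := by

  exact ⟨fun _ hA v => Sugra.lie_sub_mem_isotropy hLie hSec hX hA v,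
    fun _ hs => Sugra.gamma_sub_mem_isotropy hSec hX hs,
    fun v w => Sugra.isotropyCurv_mem hSec hX hβ hSSV v w,
    fun _ hA v w => Sugra.actCurv_eq_zero hLie hSec hX hSVV hA v w,
    fun u v w => Sugra.bianchi_algebraic hSec hSSV hSVV u v w,
    fun u v w => Sugra.bianchi_differential hLie hSec hX hβ hSSV hSVV u v w⟩
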